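/- Let $\Sigma$ be a finite alphabet, let $a_1,\dots,a_n\in\Sigma$ be distinct letters, and let $L\subseteq a_1^*a_2^*\cdots a_n^*$ be a recursively enumerable language. Then there is a CoT C-RASP with causal masking that recognizes $L$ (as a language over $\Sigma$). Here, C-RASP expressions (with causal masking) over a finite alphabet $A$ are generated by the grammar $$\varphi ::= Q_a \mid \neg\varphi\mid\varphi\wedge\varphi\mid t\le t,\qquad t::= c\mid \overleftarrow{\#}[\varphi]\mid t+t\mid t-t\qquad(a\in A,\ c\in\mathbb Z)$$ and are evaluated at a position $i$ of a word $w\in A^*$: $Q_a$ holds iff the $i$-th letter of $w$ is $a$; $\overleftarrow{\#}[\varphi]$ is the number of positions $j\in\{1,\dots,i\}$ of $w$ at which $\varphi$ holds; the other constructs have their usual meaning. A CoT C-RASP with input alphabet $\Sigma$ consists of a finite token alphabet $A\supseteq\Sigma$, a non-empty finite list of rules $O_{b_1}\leftarrow\varphi_1,\dots,O_{b_\ell}\leftarrow\varphi_\ell$ with $b_k\in A$ and $\varphi_k$ a C-RASP expression over $A$, and a set $F\subseteq A$ of accepting tokens. On a word $w\in A^*$ it outputs $b_k$ for the least $k$ such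 that $\varphi_k$ holds at the last position of $w$ (and nothing if there is no such $k$); for the empty word, every $Q_a$ is taken to be false and every count to be $0$. An input $w\in\Sigma^*$ is accepted iff, when each output token is appended to the word before the next one is computed, the program started on $w$ eventually outputs a token of $F$. The recognized language is the set of all accepted $w\in\Sigma^*$. -/

import Mathlib

universe u

namespace CRASP

/- Expressions of C-RASP with causal masking over the alphabet `A`: `Formula` is the type of
Boolean-valued expressions, `Term` the type of (integer-valued) count expressions.
The remaining connectives and the comparisons `<`, `=`, `>`, as well as integer multiples of
terms, are expressible in the usual way. -/
mutual

inductive Formula (A : Type u) : Type u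
  /-- `Q_a`: the current position carries the letter `a`. -/
  | letter (a : A) : Formula A
  | not (φ : Formula A) : Formula A
  | and (φ ψ : Formula A) : Formula A
  /-- the comparison `s ≤ t` of two count expressions. -/
  | le (s t : Term A) : Formula A

inductive Term (A : Type u) : Type u
  | const (c : ℤ) : Term A
  /-- the number of positions `j` with `j ≤ i` that satisfy `φ`, where `i` is the current
  position. -/
  | count (φ : Formula A) : Term A
  | add (s t : Term A) : Term A
  | sub (s t : Term A) : Term A

end

/- Semantics on a word `w` at position `i`. Positions are `1, …, |w|`. The value `i = 0` occurs
only at the top level, as the "last position" of the empty word; there every `Q_a` is false and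
every count is `0`. -/
open Classical in
mutual

noncomputable def Formula.Holds {A : Type u} (w : List A) : Formula A → ℕ → Prop
  | .letter a, i => 0 < i ∧ w[i - 1]? = some a
  | .not φ, i => ¬ Formula.Holds w φ i
  | .and φ ψ, i => Formula.Holds w φ i ∧ Formula.Holds w ψ i
  | .le s t, i => Term.val w s i ≤ Term.val w t i

noncomputable def Term.val {A : Type u} (w : List A) : Term A → ℕ → ℤ
  | .const c, _ => c
  | .count φ, i => (((Finset.Icc 1 i).filter (fun j => Formula.Holds w φ j)).card : ℤ)
  | .add s t, i => Term.val w s i + Term.val w t i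
  | .sub s t, i => Term.val w s i - Term.val w t i

end

end CRASP

/-- A CoT C-RASP (with causal masking) with input alphabet `α` and additional chain-of-thought
tokens `Γ`, so that the full token alphabet is `α ⊕ Γ`: a non-empty list of rules `O_b ← φ`,
together with a set of accepting tokens. -/
structure CoTCRASP (α Γ : Type*) where
  rules : List ((α ⊕ Γ) × CRASP.Formula (α ⊕ Γ))
  rules_ne_nil : rules ≠ []
  accepting : Set (α ⊕ Γ)

namespace CoTCRASP

variable {α Γ : Type*}

open Classical in
/-- The token output on the word `w`: the token of the first rule whose condition holds at the
last position of `w`; no token is output if there is no such rule. -/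
noncomputable def output (S : CoTCRASP α Γ) (w : List (α ⊕ Γ)) : Option (α ⊕ Γ) :=
  (S.rules.find? (fun r => decide (r.2.Holds w w.length))).map Prod.fst

/-- Starting from `w`, the program outputs the tokens of `u` one after the other, each output
token being appended to the word before the next one is computed. -/
def Generates (S : CoTCRASP α Γ) : List (α ⊕ Γ) → List (α ⊕ Γ) → Prop
  | _, [] => True
  | w, b :: u => S.output w = some b ∧ S.Generates (w ++ [b]) u

/-- The language recognized by `S`: the input words on which `S` eventually outputs an accepting
token. -/
def language (S : CoTCRASP α Γ) : Language α :=
  {w : List α | ∃ (u : List (α ⊕ Γ)) (b : α ⊕ Γ),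
    S.Generates (w.map Sum.inl) (u ++ [b]) ∧ b ∈ S.accepting}

end CoTCRASP

/-- The language `a₁* a₂* ⋯ aₙ*`. -/
def letterBlocks {α : Type*} {n : ℕ} (a : Fin n → α) : Language α :=
  (List.ofFn (fun i => KStar.kstar ({[a i]} : Language α))).prod

-- A word of `L` is determined by the numbers of its letters, and C-RASP can compare weighted letter
-- counts of everything written so far. So the word itself can store the registers of a machine.
-- Each input letter `a i` adds 1 to register `i`, and each chain-of-thought token adds a fixed
-- increment to a fixed register, or nothing.
--
-- The machine is a while program with instructions increment, decrement and "loop while two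
-- registers differ". Its control state is the list of programs still to be run. Only finitely many
-- such lists occur (`exists_finite_closed`), and they are the tokens. The last token and one
-- comparison of two counts determine the next token, so a C-RASP can simulate the run
-- (`exists_language_eq_halting`). The empty list is the accepting token. The first token is emitted
-- only if the input is sorted into blocks, which is a condition on all prefixes and hence itself a
-- count.
--
-- By Kleene's normal form, membership of a block word with exponents `v` means that `g (t, v) = 0`
-- for some `t`, with `g` primitive recursive. While programs compute every primitive recursive
-- function (`computes_of_primrec`), hence can search for such a `t` (`exists_search`).

namespace CRASP

-- Properties of words that C-RASP can express

variable {A : Type u}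

-- Causal masking: a position sees only what precedes it, so appending letters changes no earlier
-- value. This lets one prove facts about counts by appending one letter at a time.
mutual

theorem Formula.holds_append (w u : List A) :
    ∀ (φ : Formula A) (i : ℕ), i ≤ w.length → (φ.Holds (w ++ u) i ↔ φ.Holds w i)
  | .letter a, i, hi => by
    simp only [Formula.Holds]
    refine and_congr_right fun h => ?_
    rw [List.getElem?_append_left (by omega)]
  | .not φ, i, hi => by
    simp only [Formula.Holds]
    exact not_congr (Formula.holds_append w u φ i hi)
  | .and φ ψ, i, hi => by
    simp only [Formula.Holds]
    exact and_congr (Formula.holds_append w u φ i hi) (Formula.holds_append w u ψ i hi)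
  | .le s t, i, hi => by
    simp only [Formula.Holds]
    rw [Term.val_append w u s i hi, Term.val_append w u t i hi]

theorem Term.val_append (w u : List A) :
    ∀ (t : Term A) (i : ℕ), i ≤ w.length → t.val (w ++ u) i = t.val w i
  | .const c, i, hi => by simp only [Term.val]
  | .count φ, i, hi => by
    simp only [Term.val]
    congr 2
    classical
    ext j
    rw [Finset.mem_filter, Finset.mem_filter]
    refine and_congr_right fun hj => ?_
    exact Formula.holds_append w u φ j ((Finset.mem_Icc.1 hj).2.trans hi)
  | .add s t, i, hi => by
    simp only [Term.val]
    rw [Term.val_append w u s i hi, Term.val_append w u t i hi]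
  | .sub s t, i, hi => by
    simp only [Term.val]
    rw [Term.val_append w u s i hi, Term.val_append w u t i hi]

end

/-- `P` is the set of words at whose last position some C-RASP formula holds. -/
def Expressible (P : List A → Prop) : Prop :=
  ∃ φ : Formula A, ∀ w, φ.Holds w w.length ↔ P w

/-- `f` is the value at the last position of some C-RASP count expression. -/
def ExpressibleTerm (f : List A → ℤ) : Prop :=
  ∃ t : Term A, ∀ w, t.val w w.length = f w

theorem ExpressibleTerm.const (c : ℤ) : ExpressibleTerm fun _ : List A => c :=
  ⟨.const c, fun w => by simp only [Term.val]⟩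

theorem ExpressibleTerm.add {f g : List A → ℤ} :
    ExpressibleTerm f → ExpressibleTerm g → ExpressibleTerm fun w => f w + g w := by
  rintro ⟨s, hs⟩ ⟨t, ht⟩
  exact ⟨.add s t, fun w => by simp only [Term.val, hs, ht]⟩

theorem ExpressibleTerm.sub {f g : List A → ℤ} :
    ExpressibleTerm f → ExpressibleTerm g → ExpressibleTerm fun w => f w - g w := by
  rintro ⟨s, hs⟩ ⟨t, ht⟩
  exact ⟨.sub s t, fun w => by simp only [Term.val, hs, ht]⟩

theorem ExpressibleTerm.const_mul {f : List A → ℤ} (hf : ExpressibleTerm f) (c : ℤ) :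
    ExpressibleTerm fun w => c * f w := by
  induction c using Int.induction_on with
  | zero => simpa using ExpressibleTerm.const 0
  | succ n ih => simpa [add_mul] using ih.add hf
  | pred n ih => simpa [sub_mul] using ih.sub hf

theorem ExpressibleTerm.list_sum {ι : Type*} {f : ι → List A → ℤ}
    (hf : ∀ i, ExpressibleTerm (f i)) (l : List ι) :
    ExpressibleTerm fun w => (l.map fun i => f i w).sum := by
  induction l with
  | nil => simpa using ExpressibleTerm.const 0
  | cons i l ih => simpa using (hf i).add ih

theorem ExpressibleTerm.sum {ι : Type*} [Fintype ι] {f : ι → List A → ℤ}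
    (hf : ∀ i, ExpressibleTerm (f i)) : ExpressibleTerm fun w => ∑ i, f i w := by
  simpa using ExpressibleTerm.list_sum hf Finset.univ.toList

open Classical in
theorem Term.val_count_append_singleton (φ : Formula A) (w : List A) (x : A) :
    (Term.count φ).val (w ++ [x]) (w ++ [x]).length =
      (Term.count φ).val w w.length +
        if φ.Holds (w ++ [x]) (w ++ [x]).length then 1 else 0 := by
  rw [← Term.val_append w [x] _ _ le_rfl]
  simp only [Term.val, List.length_append, List.length_singleton]
  rw [← Finset.insert_Icc_right_eq_Icc_add_one (by omega), Finset.filter_insert]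
  split_ifs with h
  · rw [Finset.card_insert_of_notMem (by simp)]
    push_cast
    rfl
  · simp

theorem Term.val_count_zero (φ : Formula A) (w : List A) : (Term.count φ).val w 0 = 0 := by
  simp [Term.val]

theorem Expressible.congr {P Q : List A → Prop} (hP : Expressible P) (h : ∀ w, P w ↔ Q w) :
    Expressible Q :=
  (funext fun w => propext (h w) : P = Q) ▸ hP

theorem Expressible.not {P : List A → Prop} :
    Expressible P → Expressible fun w => ¬ P w := by
  rintro ⟨φ, hφ⟩
  exact ⟨.not φ, fun w => by simp only [Formula.Holds, hφ]⟩

theorem Expressible.and {P Q : List A → Prop} :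
    Expressible P → Expressible Q → Expressible fun w => P w ∧ Q w := by
  rintro ⟨φ, hφ⟩ ⟨ψ, hψ⟩
  exact ⟨.and φ ψ, fun w => by simp only [Formula.Holds, hφ, hψ]⟩

theorem Expressible.or {P Q : List A → Prop} (hP : Expressible P) (hQ : Expressible Q) :
    Expressible fun w => P w ∨ Q w :=
  (hP.not.and hQ.not).not.congr fun w => by tauto

theorem ExpressibleTerm.le {f g : List A → ℤ} :
    ExpressibleTerm f → ExpressibleTerm g → Expressible fun w => f w ≤ g w := by
  rintro ⟨s, hs⟩ ⟨t, ht⟩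
  exact ⟨.le s t, fun w => by simp only [Formula.Holds, hs, ht]⟩

theorem ExpressibleTerm.eq {f g : List A → ℤ} (hf : ExpressibleTerm f)
    (hg : ExpressibleTerm g) : Expressible fun w => f w = g w :=
  ((hf.le hg).and (hg.le hf)).congr fun w => by omega

theorem Expressible.const (p : Prop) : Expressible fun _ : List A => p := by
  by_cases h : p
  · exact ((ExpressibleTerm.const 0).le (ExpressibleTerm.const 0)).congr fun w => by simp [h]
  · exact ((ExpressibleTerm.const 1).le (ExpressibleTerm.const 0)).congr fun w => by simp [h]

theorem Expressible.list_exists {ι : Type*} {P : ι → List A → Prop}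
    (hP : ∀ i, Expressible (P i)) (l : List ι) : Expressible fun w => ∃ i ∈ l, P i w := by
  induction l with
  | nil => simpa using Expressible.const False
  | cons i l ih => simpa using (hP i).or ih

theorem Expressible.exists {ι : Type*} [Finite ι] {P : ι → List A → Prop}
    (hP : ∀ i, Expressible (P i)) : Expressible fun w => ∃ i, P i w := by
  have := Fintype.ofFinite ι
  simpa using Expressible.list_exists hP Finset.univ.toList

theorem Expressible.forall {ι : Type*} [Finite ι] {P : ι → List A → Prop}
    (hP : ∀ i, Expressible (P i)) : Expressible fun w => ∀ i, P i w :=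
  (Expressible.exists fun i => (hP i).not).not.congr fun w => by simp

theorem Expressible.getLast?_eq (a : A) : Expressible fun w => w.getLast? = some a := by
  refine ⟨.letter a, fun w => ?_⟩
  simp only [Formula.Holds, List.getLast?_eq_getElem?]
  refine ⟨And.right, fun h => ⟨?_, h⟩⟩
  rw [List.length_pos_iff]
  rintro rfl
  simp at h

/-- Weighted letter counts are expressible. -/
theorem ExpressibleTerm.map_sum [Finite A] (c : A → ℤ) :
    ExpressibleTerm fun w => (w.map c).sum := by
  classical
  have := Fintype.ofFinite A
  have hcount (a : A) : ExpressibleTerm fun w => (w.count a : ℤ) := by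
    refine ⟨.count (.letter a), fun w => ?_⟩
    induction w using List.reverseRecOn with
    | nil => simp [Term.val_count_zero]
    | append_singleton w x ih =>
      rw [Term.val_count_append_singleton, ih]
      simp only [Formula.Holds]
      simp [List.count_singleton]
  obtain ⟨t, ht⟩ := ExpressibleTerm.sum fun a => (hcount a).const_mul (c a)
  refine ⟨t, fun w => ?_⟩
  rw [ht]
  beta_reduce
  rw [Finset.sum_list_map_count, ← Finset.sum_subset (Finset.subset_univ w.toFinset)]
  · simp [mul_comm]
  · intro x _ hx
    simp [List.count_eq_zero_of_not_mem (by simpa using hx)]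

/-- By causality, the positions of `w` where a formula holds correspond to the nonempty prefixes it
accepts. So the condition says that the number of positions violating `P` is 0. Position 0 is never
counted, whence `hnil`. -/
theorem Expressible.forall_prefix {P : List A → Prop} (hP : Expressible P) (hnil : P []) :
    Expressible fun w => ∀ u, u <+: w → P u := by
  obtain ⟨φ, hφ⟩ := hP.not
  have hpos (w : List A) : 0 ≤ (Term.count φ).val w w.length := by simp [Term.val]
  refine ⟨.le (.count φ) (.const 0), fun w => ?_⟩
  suffices (Term.count φ).val w w.length ≤ 0 ↔ ∀ u, u <+: w → P u by
    beta_reduce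
    rw [← this, Formula.Holds, Term.val.eq_1]
  induction w using List.reverseRecOn with
  | nil => simp [Term.val_count_zero, hnil]
  | append_singleton w x ih =>
    rw [Term.val_count_append_singleton]
    simp only [List.prefix_concat_iff, forall_eq_or_imp]
    rw [← ih]
    have := hpos w
    split_ifs with h <;> rw [hφ] at h
    · simp only [h, false_and, iff_false]
      omega
    · simpa using fun _ => not_not.1 h

end CRASP

-- Output functions and deterministic runs

namespace CoTCRASP

variable {α Γ : Type*}

/-- A next-token function all of whose fibres are expressible is the output function of
a CoT C-RASP. -/
theorem exists_output_eq [Finite (α ⊕ Γ)] [Nonempty (α ⊕ Γ)] (out : List (α ⊕ Γ) → Option (α ⊕ Γ))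
    (hout : ∀ b, CRASP.Expressible fun w => out w = some b) (F : Set (α ⊕ Γ)) :
    ∃ S : CoTCRASP α Γ, S.accepting = F ∧ S.output = out := by
  classical
  have := Fintype.ofFinite (α ⊕ Γ)
  -- One rule per token; the conditions exclude each other, so the order of the rules is immaterial.
  choose φ hφ using hout
  refine ⟨⟨Finset.univ.toList.map fun b => (b, φ b), by
    simp [Finset.univ_eq_empty_iff], F⟩, rfl, ?_⟩
  funext w
  simp only [output, List.find?_map, Option.map_map]
  simp only [Function.comp_def, hφ, Option.map_id']
  cases h : out w with
  | none => simp
  | some b =>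
    cases hl : Finset.univ.toList.find? fun c : α ⊕ Γ => decide (some b = some c) with
    | none => simpa using List.find?_eq_none.1 hl b
    | some c => simpa [eq_comm] using List.find?_some hl

theorem generates_iff {S : CoTCRASP α Γ} {W : ℕ → List (α ⊕ Γ)} {t : ℕ → α ⊕ Γ}
    (hW : ∀ m, W (m + 1) = W m ++ [t m]) (ht : ∀ m, S.output (W m) = some (t m))
    (u : List (α ⊕ Γ)) (m : ℕ) :
    S.Generates (W m) u ↔ u = (List.range' m u.length).map t := by
  induction u generalizing m with
  | nil => simp [Generates]
  | cons b u ih =>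
    simp only [Generates, ht, Option.some.injEq, List.length_cons, List.range'_succ, List.map_cons,
      List.cons.injEq]
    constructor
    · rintro ⟨rfl, h⟩
      rw [← hW, ih] at h
      exact ⟨rfl, h⟩
    · rintro ⟨rfl, h⟩
      rw [← hW, ih]
      exact ⟨rfl, h⟩

theorem exists_generates_iff {S : CoTCRASP α Γ} {W : ℕ → List (α ⊕ Γ)} {t : ℕ → α ⊕ Γ}
    (hW : ∀ m, W (m + 1) = W m ++ [t m]) (ht : ∀ m, S.output (W m) = some (t m)) :
    (∃ u b, S.Generates (W 0) (u ++ [b]) ∧ b ∈ S.accepting) ↔ ∃ m, t m ∈ S.accepting := by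
  simp only [generates_iff hW ht]
  constructor
  · rintro ⟨u, b, h, hb⟩
    have hm : b ∈ u ++ [b] := by simp
    rw [h, List.mem_map] at hm
    obtain ⟨m, -, rfl⟩ := hm
    exact ⟨m, hb⟩
  · rintro ⟨m, hm⟩
    exact ⟨(List.range' 0 m).map t, t m, by simp [List.range'_concat], hm⟩

end CoTCRASP

/-- While programs over integer registers. -/
inductive WhileProg : Type
  | inc (r : ℕ)
  | dec (r : ℕ)
  | seq (p q : WhileProg)
  /-- repeat `p` as long as the registers `a` and `b` differ. -/
  | loop (a b : ℕ) (p : WhileProg)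

-- While programs and their finite control

namespace WhileProg

/-- The amount by which executing the head of a list of programs changes a register at once. -/
def effect : List WhileProg → ℕ → ℤ
  | inc r :: _, i => if i = r then 1 else 0
  | dec r :: _, i => if i = r then -1 else 0
  | _, _ => 0

/-- The registers compared on executing the head of a list of programs. -/
def test : List WhileProg → ℕ × ℕ
  | loop a b _ :: _ => (a, b)
  | _ => (0, 0)

/-- The remaining programs if the compared registers agree. -/
def yes : List WhileProg → List WhileProg
  | [] => []
  | seq p q :: K => p :: q :: K
  | _ :: K => K

/-- The remaining programs if the compared registers differ. -/
def no : List WhileProg → List WhileProg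
  | [] => []
  | inc _ :: K => K
  | dec _ :: K => K
  | seq p q :: K => p :: q :: K
  | loop a b p :: K => p :: loop a b p :: K

/-- One execution step. -/
def step (c : List WhileProg × (ℕ → ℤ)) : List WhileProg × (ℕ → ℤ) :=
  (if (c.2 + effect c.1) (test c.1).1 = (c.2 + effect c.1) (test c.1).2 then yes c.1 else no c.1,
    c.2 + effect c.1)

/-- Executing `P` on the register contents `R` results in `R'`. -/
def Runs (P : WhileProg) (R R' : ℕ → ℤ) : Prop :=
  ∀ K, ∃ m, step^[m] (P :: K, R) = (K, R')

theorem effect_inc (r : ℕ) (K : List WhileProg) (R : ℕ → ℤ) :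
    R + effect (inc r :: K) = Function.update R r (R r + 1) := by
  funext i
  by_cases h : i = r
  · subst h; simp [effect]
  · simp [effect, h]

theorem effect_dec (r : ℕ) (K : List WhileProg) (R : ℕ → ℤ) :
    R + effect (dec r :: K) = Function.update R r (R r - 1) := by
  funext i
  by_cases h : i = r
  · subst h; simp [effect]; ring
  · simp [effect, h]

theorem runs_inc (r : ℕ) (R : ℕ → ℤ) : Runs (inc r) R (Function.update R r (R r + 1)) :=
  fun K => ⟨1, by
    rw [Function.iterate_one, step, effect_inc]
    -- An instruction other than `loop` tests register 0 against itself, so the branch `yes` is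
    -- taken.
    simp [test, yes]⟩

theorem runs_dec (r : ℕ) (R : ℕ → ℤ) : Runs (dec r) R (Function.update R r (R r - 1)) :=
  fun K => ⟨1, by
    rw [Function.iterate_one, step, effect_dec]
    simp [test, yes]⟩

theorem step_seq (p q : WhileProg) (K : List WhileProg) (R : ℕ → ℤ) :
    step (seq p q :: K, R) = (p :: q :: K, R) := by
  have : effect (seq p q :: K) = 0 := rfl
  simp [step, this, yes, no]

theorem step_loop_of_eq {a b : ℕ} (p : WhileProg) (K : List WhileProg) {R : ℕ → ℤ}
    (h : R a = R b) : step (loop a b p :: K, R) = (K, R) := by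
  have : effect (loop a b p :: K) = 0 := rfl
  simp [step, this, yes, test, h]

theorem step_loop_of_ne {a b : ℕ} (p : WhileProg) (K : List WhileProg) {R : ℕ → ℤ}
    (h : R a ≠ R b) : step (loop a b p :: K, R) = (p :: loop a b p :: K, R) := by
  have : effect (loop a b p :: K) = 0 := rfl
  simp [step, this, no, test, h]

theorem iterate_step_nil (m : ℕ) (R : ℕ → ℤ) : step^[m] ([], R) = ([], R) := by
  have : effect [] = 0 := rfl
  exact Function.iterate_fixed (by simp [step, this, yes, no]) m

theorem Runs.seq {p q : WhileProg} {R R' R'' : ℕ → ℤ} (hp : Runs p R R') (hq : Runs q R' R'') :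
    Runs (p.seq q) R R'' := by
  intro K
  obtain ⟨m, hm⟩ := hp (q :: K)
  obtain ⟨l, hl⟩ := hq K
  exact ⟨l + m + 1, by rw [Function.iterate_succ_apply, step_seq, Function.iterate_add_apply, hm, hl]⟩

theorem runs_loop_of_eq {a b : ℕ} (p : WhileProg) {R : ℕ → ℤ} (h : R a = R b) :
    Runs (loop a b p) R R :=
  fun K => ⟨1, step_loop_of_eq p K h⟩

theorem Runs.loop {a b : ℕ} {p : WhileProg} {R R' R'' : ℕ → ℤ} (h : R a ≠ R b)
    (hp : Runs p R R') (hq : Runs (loop a b p) R' R'') : Runs (loop a b p) R R'' := by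
  intro K
  obtain ⟨m, hm⟩ := hp (WhileProg.loop a b p :: K)
  obtain ⟨l, hl⟩ := hq K
  exact ⟨l + m + 1,
    by rw [Function.iterate_succ_apply, step_loop_of_ne _ _ h, Function.iterate_add_apply, hm, hl]⟩

/-- The lists of programs met in executing `P` before reaching the continuation `K`. -/
def conts : WhileProg → List WhileProg → Set (List WhileProg)
  | inc r, K => {inc r :: K}
  | dec r, K => {dec r :: K}
  | seq p q, K => {seq p q :: K} ∪ conts p (q :: K) ∪ conts q K
  | loop a b p, K => {loop a b p :: K} ∪ conts p (loop a b p :: K)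

theorem conts_finite (P : WhileProg) (K : List WhileProg) : (conts P K).Finite := by
  induction P generalizing K with
  | inc r => exact Set.finite_singleton _
  | dec r => exact Set.finite_singleton _
  | seq p q hp hq => exact ((Set.finite_singleton _).union (hp _)).union (hq _)
  | loop a b p hp => exact (Set.finite_singleton _).union (hp _)

theorem cons_mem_conts (P : WhileProg) (K : List WhileProg) : P :: K ∈ conts P K := by
  cases P <;> simp [conts]

/-- Control can leave `conts P K` only through `K`. For a subprogram, the exit is again the start of
a set of the union, or `K` itself. -/
theorem yes_no_mem_conts {P : WhileProg} {K x : List WhileProg} (hx : x ∈ conts P K) :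
    (yes x ∈ conts P K ∨ yes x = K) ∧ (no x ∈ conts P K ∨ no x = K) := by
  induction P generalizing K with
  | inc r =>
    obtain rfl : x = _ := hx
    simp [yes, no]
  | dec r =>
    obtain rfl : x = _ := hx
    simp [yes, no]
  | seq p q hp hq =>
    have h1 := cons_mem_conts p (q :: K)
    have h2 := cons_mem_conts q K
    rcases hx with (hx | hx) | hx
    · obtain rfl : x = _ := hx
      simp [yes, no, conts, h1]
    · have := hp hx
      simp only [conts, Set.mem_union]
      grind
    · have := hq hx
      simp only [conts, Set.mem_union]
      grind
  | loop a b p hp =>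
    have h1 := cons_mem_conts p (loop a b p :: K)
    rcases hx with hx | hx
    · obtain rfl : x = _ := hx
      simp [yes, no, conts, h1]
    · have := hp hx
      simp only [conts, Set.mem_union, Set.mem_singleton_iff]
      grind

theorem exists_finite_closed (P : WhileProg) : ∃ S : Set (List WhileProg), S.Finite ∧ [P] ∈ S ∧
    [] ∈ S ∧ (∀ x ∈ S, yes x ∈ S) ∧ ∀ x ∈ S, no x ∈ S := by
  refine ⟨insert [] (conts P []), (conts_finite P []).insert _, .inr (cons_mem_conts P []),
    .inl rfl, ?_, ?_⟩
  · rintro x (rfl | hx)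
    · exact .inl rfl
    · exact (yes_no_mem_conts hx).1.symm
  · rintro x (rfl | hx)
    · exact .inl rfl
    · exact (yes_no_mem_conts hx).2.symm

-- Primitive recursive functions by while programs

/-- Decrease register `r` down to the contents of register `z`, which is meant to be zero. -/
def clear (r z : ℕ) : WhileProg := loop r z (dec r)

/-- Increase register `r` up to the contents of register `s`. -/
def copy (r s : ℕ) : WhileProg := loop r s (inc r)

theorem runs_clear {r z : ℕ} (hrz : r ≠ z) {R : ℕ → ℤ} (hz : R z = 0) (hr : 0 ≤ R r) :
    Runs (clear r z) R (Function.update R r 0) := by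
  obtain ⟨m, hm⟩ := Int.eq_ofNat_of_zero_le hr
  clear hr
  induction m generalizing R with
  | zero =>
    rw [Function.update_eq_self_iff.2 (by simp [hm])]
    exact runs_loop_of_eq _ (by simp [hm, hz])
  | succ m ih =>
    refine (runs_dec r R).loop (by rw [hm, hz]; simp; omega) ?_
    have := @ih (Function.update R r (R r - 1)) (by simpa [hrz.symm] using hz) (by simp [hm])
    simpa [clear] using this

theorem runs_copy {r s : ℕ} (hrs : r ≠ s) {R : ℕ → ℤ} (h : R r ≤ R s) :
    Runs (copy r s) R (Function.update R r (R s)) := by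
  obtain ⟨m, hm⟩ := Int.le.dest h
  clear h
  induction m generalizing R with
  | zero =>
    rw [Function.update_eq_self_iff.2 (by simp [← hm])]
    exact runs_loop_of_eq _ (by simp [← hm])
  | succ m ih =>
    refine (runs_inc r R).loop (by rw [← hm]; simp; omega) ?_
    have := @ih (Function.update R r (R r + 1)) (by simp [hrs.symm, ← hm]; ring)
    simpa [copy, hrs.symm] using this

/-- `f` is computed by while programs that read their arguments from arbitrary registers below
`k`, write the result to register `k`, and use the registers above as scratch space. -/
def Computes {n : ℕ} (f : List.Vector ℕ n → ℕ) : Prop :=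
  ∀ (inp : Fin n → ℕ) (k : ℕ), (∀ i, inp i < k) → ∃ P, ∀ (R : ℕ → ℤ) (v : List.Vector ℕ n),
    (∀ j, k ≤ j → R j = 0) → (∀ i, R (inp i) = v.get i) → Runs P R (Function.update R k (f v))

theorem computes_zero : Computes fun _ : List.Vector ℕ 0 => 0 := by
  -- `loop 0 0 _` does nothing: a register never differs from itself.
  refine fun inp k _ => ⟨loop 0 0 (inc 0), fun R v hR _ => ?_⟩
  rw [Function.update_eq_self_iff.2 (by simp [hR])]
  exact runs_loop_of_eq _ rfl

theorem computes_get {n : ℕ} (i : Fin n) : Computes fun v => v.get i := by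
  refine fun inp k hk => ⟨copy k (inp i), fun R v hR hv => ?_⟩
  rw [← hv i]
  exact runs_copy (hk i).ne' (by rw [hR k le_rfl, hv]; simp)

theorem computes_succ : Computes fun v : List.Vector ℕ 1 => v.head.succ := by
  intro inp k hk
  refine ⟨(copy k (inp 0)).seq (inc k), fun R v hR hv => ?_⟩
  have := (runs_copy (R := R) (hk 0).ne' (by rw [hR k le_rfl, hv]; simp)).seq (runs_inc k _)
  simpa [hv 0] using this

theorem exists_runs_forall {m n : ℕ} (g : Fin m → List.Vector ℕ n → ℕ)
    (hg : ∀ i, Computes (g i)) (inp : Fin n → ℕ) (k : ℕ) (hk : ∀ i, inp i < k) :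
    ∃ P, ∀ (R : ℕ → ℤ) (v : List.Vector ℕ n), (∀ j, k ≤ j → R j = 0) →
      (∀ i, R (inp i) = v.get i) →
      ∃ R', Runs P R R' ∧ (∀ j, j < k → R' j = R j) ∧ (∀ i : Fin m, R' (k + i) = g i v) ∧
        ∀ j, k + m ≤ j → R' j = 0 := by
  induction m with
  | zero =>
    exact ⟨loop 0 0 (inc 0), fun R v hR hv =>
      ⟨R, runs_loop_of_eq _ rfl, fun _ _ => rfl, fun i => i.elim0, fun j hj => hR j hj⟩⟩
  | succ m ih =>
    obtain ⟨P, hP⟩ := ih (fun i => g i.castSucc) fun i => hg _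
    obtain ⟨Q, hQ⟩ := hg (Fin.last m) inp (k + m) fun i => (hk i).trans_le (by omega)
    refine ⟨P.seq Q, fun R v hR hv => ?_⟩
    obtain ⟨R', h1, h2, h3, h4⟩ := hP R v hR hv
    refine ⟨_, h1.seq (hQ R' v h4 fun i => by rw [h2 _ (hk i), hv]), fun j hj => ?_,
      fun i => ?_, fun j hj => ?_⟩
    · rw [Function.update_of_ne (by omega), h2 j hj]
    · induction i using Fin.lastCases with
      | last => simp
      | cast i =>
        rw [Function.update_of_ne (by simp; omega)]
        exact h3 i
    · rw [Function.update_of_ne (by omega), h4 j (by omega)]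

theorem exists_runs_clear (k m z : ℕ) (hz : k + m ≤ z) :
    ∃ P, ∀ R : ℕ → ℤ, R z = 0 → (∀ j, k ≤ j → j < k + m → 0 ≤ R j) →
      Runs P R fun j => if k ≤ j ∧ j < k + m then 0 else R j := by
  induction m with
  | zero =>
    refine ⟨loop 0 0 (inc 0), fun R hR _ => ?_⟩
    convert runs_loop_of_eq (inc 0) rfl using 1
    funext j
    simp
  | succ m ih =>
    obtain ⟨P, hP⟩ := ih (by omega)
    refine ⟨(clear (k + m) z).seq P, fun R hR hpos => ?_⟩
    have h := hP (Function.update R (k + m) 0) (by rw [Function.update_of_ne (by omega), hR])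
      fun j h1 h2 => by
        rw [Function.update_of_ne (by omega)]
        exact hpos j h1 (by omega)
    convert (runs_clear (by omega) hR (hpos (k + m) (by omega) (by omega))).seq h using 1
    funext j
    by_cases hj : j = k + m
    · subst hj; simp
    · rw [Function.update_of_ne hj]
      congr 1
      apply propext
      omega

theorem Computes.comp {m n : ℕ} {f : List.Vector ℕ m → ℕ} {g : Fin m → List.Vector ℕ n → ℕ}
    (hf : Computes f) (hg : ∀ i, Computes (g i)) :
    Computes fun v => f (List.Vector.ofFn fun i => g i v) := by
  intro inp k hk
  -- Register `k` is kept for the result, `k + 1, …, k + m` hold the values of the `g i`, and `k + 1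
  -- + m` that of `f`. Register `k + m + 2` stays zero and serves to clear the scratch registers.
  obtain ⟨P, hP⟩ := exists_runs_forall g hg inp (k + 1) fun i => (hk i).trans_le (by omega)
  obtain ⟨Q, hQ⟩ := hf (fun i => k + 1 + i) (k + 1 + m) fun i => by omega
  obtain ⟨C, hC⟩ := exists_runs_clear (k + 1) (m + 1) (k + m + 2) (by omega)
  refine ⟨((P.seq Q).seq (copy k (k + 1 + m))).seq C, fun R v hR hv => ?_⟩
  obtain ⟨R', h1, h2, h3, h4⟩ := hP R v (fun j hj => hR j (by omega)) hv
  have h5 := hQ R' (List.Vector.ofFn fun i => g i v) h4 fun i => by simp [h3]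
  set y := f (List.Vector.ofFn fun i => g i v)
  have h6 := runs_copy (r := k) (s := k + 1 + m) (R := Function.update R' (k + 1 + m) y) (by omega)
    (by
      rw [Function.update_of_ne (by omega), h2 k (by omega), hR k le_rfl]
      simp)
  have h7 := hC (Function.update (Function.update R' (k + 1 + m) y) k y) ?_ ?_
  · rw [Function.update_self] at h6
    convert ((h1.seq h5).seq h6).seq h7 using 1
    funext j
    rcases lt_trichotomy j k with hj | rfl | hj
    · rw [if_neg (by omega), Function.update_of_ne hj.ne, Function.update_of_ne hj.ne,
        Function.update_of_ne (by omega), h2 j (by omega)]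
    · simp [y]
    · rw [Function.update_of_ne hj.ne', hR j hj.le]
      split_ifs with h
      · rfl
      · rw [Function.update_of_ne hj.ne', Function.update_of_ne (by omega), h4 j (by omega)]
  · rw [Function.update_of_ne (by omega), Function.update_of_ne (by omega), h4 _ (by omega)]
  · intro j hj1 hj2
    rw [Function.update_of_ne (by omega)]
    by_cases hj : j = k + 1 + m
    · subst hj; simp
    · rw [Function.update_of_ne hj]
      obtain ⟨i, rfl⟩ := Nat.exists_eq_add_of_le hj1
      rw [h3 ⟨i, by omega⟩]
      simp

theorem Computes.prec {n : ℕ} {f : List.Vector ℕ n → ℕ} {g : List.Vector ℕ (n + 2) → ℕ}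
    (hf : Computes f) (hg : Computes g) :
    Computes fun v : List.Vector ℕ (n + 1) =>
      v.head.rec (f v.tail) fun y IH => g (y ::ᵥ IH ::ᵥ v.tail) := by
  intro inp k hk
  obtain ⟨P, hP⟩ := hf (fun i => inp i.succ) k fun i => hk _
  obtain ⟨Q, hQ⟩ := hg (Fin.cons (k + 1) (Fin.cons k fun i => inp i.succ)) (k + 2) (by
    refine Fin.cases (by simp) (Fin.cases (by simp) fun i => ?_)
    have := hk i.succ
    simp; omega)
  -- Register `k` accumulates the value, `k + 1` counts the rounds, `k + 2` receives the value of
  -- `g`, and `k + 3` is zero between subprograms.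
  let body := (((Q.seq (clear k (k + 3))).seq (copy k (k + 2))).seq (clear (k + 2) (k + 3))).seq
    (inc (k + 1))
  refine ⟨(P.seq (loop (k + 1) (inp 0) body)).seq (clear (k + 1) (k + 2)), fun R v hR hv => ?_⟩
  beta_reduce
  obtain ⟨F, hF0, hFs, hFv⟩ : ∃ F : ℕ → ℕ, F 0 = f v.tail ∧
      (∀ y, F (y + 1) = g (y ::ᵥ F y ::ᵥ v.tail)) ∧
      v.head.rec (f v.tail) (fun y IH => g (y ::ᵥ IH ::ᵥ v.tail)) = F v.head :=
    ⟨fun y => y.rec (f v.tail) fun y IH => g (y ::ᵥ IH ::ᵥ v.tail), rfl, fun _ => rfl, rfl⟩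
  rw [hFv]
  -- The register contents after `y` rounds of the loop.
  let T : ℕ → ℕ → ℤ := fun y => Function.update (Function.update R k (F y)) (k + 1) y
  have hget (i : Fin n) : v.tail.get i = v.get i.succ := by simp
  have hlow (y j : ℕ) (hj : j < k) : T y j = R j := by
    simp only [T]
    rw [Function.update_of_ne (by omega), Function.update_of_ne (by omega)]
  have hhigh (y j : ℕ) (hj : k + 2 ≤ j) : T y j = 0 := by
    simp only [T]
    rw [Function.update_of_ne (by omega), Function.update_of_ne (by omega), hR j (by omega)]
  have hTk (y : ℕ) : T y k = F y := by simp [T]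
  have hTk1 (y : ℕ) : T y (k + 1) = y := by simp [T]
  have hbody (y : ℕ) : Runs body (T y) (T (y + 1)) := by
    have h1 := hQ (T y) (y ::ᵥ F y ::ᵥ v.tail) (hhigh y) (by
      refine Fin.cases ?_ (Fin.cases ?_ fun i => ?_)
      · simpa using hTk1 y
      · exact hTk y
      · simpa [hlow y _ (hk _)] using hv i.succ)
    rw [← hFs] at h1
    have h2 := runs_clear (r := k) (z := k + 3) (R := Function.update (T y) (k + 2) (F (y + 1)))
      (by omega) (by rw [Function.update_of_ne (by omega), hhigh _ _ (by omega)])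
      (by rw [Function.update_of_ne (by omega), hTk]; simp)
    have h3 := runs_copy (r := k) (s := k + 2)
      (R := Function.update (Function.update (T y) (k + 2) (F (y + 1))) k 0) (by omega) (by simp)
    have h4 := runs_clear (r := k + 2) (z := k + 3)
      (R := Function.update (Function.update (T y) (k + 2) (F (y + 1))) k (F (y + 1)))
      (by omega) (by simp [hhigh]) (by simp)
    have h5 := ((h1.seq h2).seq (by simpa using h3)).seq h4
    convert h5.seq (runs_inc (k + 1) _) using 1
    funext j
    have := hhigh y (k + 2) le_rfl
    simp only [T, Function.update_apply] at this ⊢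
    split_ifs <;> first | omega | simp_all
  have hloop (d y : ℕ) (hd : y + d = v.head) : Runs (loop (k + 1) (inp 0) body) (T y) (T v.head) := by
    have hin : T y (inp 0) = v.head := by simpa [hlow y _ (hk 0)] using hv 0
    induction d generalizing y with
    | zero =>
      obtain rfl : y = v.head := hd
      exact runs_loop_of_eq _ (by rw [hin, hTk1])
    | succ d ih =>
      exact (hbody y).loop (by rw [hin, hTk1]; norm_cast; omega)
        (ih (y + 1) (by omega) (by simpa [hlow _ _ (hk 0)] using hv 0))
  have h0 : T 0 = Function.update R k (f v.tail) := by
    simp only [T]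
    rw [hF0]
    exact Function.update_eq_self_iff.2 (by simp [hR])
  have h1 := hP R v.tail hR fun i => by rw [hv, hget]
  rw [← h0] at h1
  have h2 := runs_clear (r := k + 1) (z := k + 2) (R := T v.head) (by omega)
    (hhigh _ _ le_rfl) (by rw [hTk1]; simp)
  convert (h1.seq (hloop v.head 0 (by omega))).seq h2 using 1
  funext j
  have := hR (k + 1) (by omega)
  simp only [T, Function.update_apply]
  split_ifs <;> first | omega | simp_all

theorem computes_of_primrec {n : ℕ} {f : List.Vector ℕ n → ℕ} (hf : Nat.Primrec' f) :
    Computes f := by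
  induction hf with
  | zero => exact computes_zero
  | succ => exact computes_succ
  | get i => exact computes_get i
  | comp g _ _ hf hg => exact hf.comp hg
  | prec _ _ hf hg => exact hf.prec hg

end WhileProg

-- Normal form for recursively enumerable sets of block words

/-- The word `a₁ ^ v₁ ⋯ aₙ ^ vₙ`. -/
def blockWord {α : Type*} {n : ℕ} (a : Fin n → α) (v : List.Vector ℕ n) : List α :=
  (List.ofFn fun i => List.replicate (v.get i) (a i)).flatten

theorem primrec_blockWord {α : Type*} [Primcodable α] {n : ℕ} (a : Fin n → α) :
    Primrec (blockWord a) := by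
  refine Primrec.list_flatten.comp (Primrec.list_ofFn fun i => ?_)
  have h : Primrec fun v : List.Vector ℕ n => (List.range (v.get i)).map fun _ => a i :=
    Primrec.list_map (Primrec.list_range.comp (Primrec.vector_get.comp .id (.const i)))
      (Primrec.const (a i)).to₂
  exact h.of_eq fun v => by simp

/-- Kleene's normal form for a recursively enumerable set of words, restricted to block words. -/
theorem exists_primrec_blockWord {α : Type*} [Primcodable α] {n : ℕ} (a : Fin n → α)
    {p : List α → Prop} (hp : REPred p) :
    ∃ g : List.Vector ℕ (n + 1) → ℕ, Nat.Primrec' g ∧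
      ∀ v, p (blockWord a v) ↔ ∃ t, g (t ::ᵥ v) = 0 := by
  obtain ⟨c, hc⟩ := Nat.Partrec.Code.exists_code.1 hp
  -- The first argument bounds the evaluation of `c`; only halting matters, not the value returned.
  let g : List.Vector ℕ (n + 1) → ℕ := fun v =>
    if (Nat.Partrec.Code.evaln v.head c (Encodable.encode (blockWord a v.tail))).isSome then 0
    else 1
  have hg : Primrec g := by
    refine Primrec.ite ?_ (.const 0) (.const 1)
    refine Primrec.primrecPred ((Primrec.option_isSome.comp
      (Nat.Partrec.Code.primrec_evaln.comp ((Primrec.vector_head.pair (.const c)).pair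
        (Primrec.encode.comp ((primrec_blockWord a).comp Primrec.vector_tail))))).of_eq
      fun v => by simp)
  refine ⟨g, Nat.Primrec'.prim_iff.2 hg, fun v => ?_⟩
  have h1 : p (blockWord a v) ↔ (c.eval (Encodable.encode (blockWord a v))).Dom := by
    rw [hc]
    simp [Part.assert]
  rw [h1, Part.dom_iff_mem]
  simp only [Nat.Partrec.Code.evaln_complete, g, List.Vector.head_cons, List.Vector.tail_cons,
    ite_eq_left_iff, one_ne_zero, imp_false, not_not, Option.isSome_iff_exists, Option.mem_def]
  exact exists_comm

-- Unbounded search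

namespace WhileProg

/-- The register contents that hold `v` in the lowest registers and are zero elsewhere. -/
def initial {n : ℕ} (v : List.Vector ℕ n) (r : ℕ) : ℤ :=
  if h : r < n then v.get ⟨r, h⟩ else 0

/-- A while program can search for a zero of a primitive recursive function. -/
theorem exists_search {n : ℕ} {g : List.Vector ℕ (n + 1) → ℕ} (hg : Nat.Primrec' g) :
    ∃ P, ∀ v, (∃ m, (step^[m] ([P], initial v)).1 = []) ↔ ∃ t, g (t ::ᵥ v) = 0 := by
  obtain ⟨Q, hQ⟩ := computes_of_primrec hg (Fin.cons n fun i => i) (n + 1)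
    (by refine Fin.cases (by simp) fun i => ?_; simp)
  -- Register `n` holds the candidate `t`, `n + 1` the value of `g`, and `n + 2` is zero. `T t` and
  -- `T' t` below are the contents before and after `Q` evaluates `g` at `t`.
  let body := ((clear (n + 1) (n + 2)).seq (inc n)).seq Q
  let W := loop (n + 1) (n + 2) body
  refine ⟨Q.seq W, fun v => ?_⟩
  let T : ℕ → ℕ → ℤ := fun t => Function.update (initial v) n t
  let T' : ℕ → ℕ → ℤ := fun t => Function.update (T t) (n + 1) (g (t ::ᵥ v))
  have hT (t j : ℕ) (hj : n + 1 ≤ j) : T t j = 0 := by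
    simp only [T]
    rw [Function.update_of_ne (by omega), initial, dif_neg (by omega)]
  have hrun (t : ℕ) : Runs Q (T t) (T' t) := by
    refine hQ (T t) (t ::ᵥ v) (hT t) (Fin.cases (by simp [T]) fun i => ?_)
    simp only [T, Fin.cons_succ, List.Vector.get_cons_succ]
    rw [Function.update_of_ne (by omega), initial, dif_pos i.2]
  have hbody (t : ℕ) : Runs body (T' t) (T' (t + 1)) := by
    have h1 := runs_clear (r := n + 1) (z := n + 2) (R := T' t) (by omega)
      (by simp [T', hT]) (by simp [T'])
    have h2 : Function.update (T' t) (n + 1) 0 = T t := by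
      simp only [T', Function.update_idem]
      exact Function.update_eq_self_iff.2 (hT t _ le_rfl).symm
    have h3 := runs_inc n (T t)
    have h4 : Function.update (T t) n (T t n + 1) = T (t + 1) := by simp [T]
    rw [h2] at h1
    rw [h4] at h3
    exact (h1.seq h3).seq (hrun (t + 1))
  have h0 : initial v = T 0 := by
    refine (Function.update_eq_self_iff.2 ?_).symm
    simp [initial]
  have hz (t : ℕ) : T' t (n + 1) = T' t (n + 2) ↔ g (t ::ᵥ v) = 0 := by
    simp [T', hT]
  obtain ⟨m₀, hm₀⟩ : ∃ m, step^[m] ([Q.seq W], initial v) = ([W], T' 0) := by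
    obtain ⟨m, hm⟩ := hrun 0 [W]
    exact ⟨m + 1, by rw [Function.iterate_succ_apply, step_seq, h0, hm]⟩
  have hnext (t : ℕ) (ht : g (t ::ᵥ v) ≠ 0) :
      ∃ m, step^[m + 1] ([W], T' t) = ([W], T' (t + 1)) := by
    obtain ⟨m, hm⟩ := hbody t [W]
    exact ⟨m, by rw [Function.iterate_succ_apply, step_loop_of_ne _ _ ((hz t).not.2 ht), hm]⟩
  have habs {c : List WhileProg × (ℕ → ℤ)} {m l : ℕ} (hml : m ≤ l) (h : (step^[m] c).1 = []) :
      (step^[l] c).1 = [] := by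
    obtain ⟨d, rfl⟩ := Nat.exists_eq_add_of_le' hml
    rw [Function.iterate_add_apply, ← Prod.mk.eta (p := step^[m] c), h, iterate_step_nil]
  constructor
  · rintro ⟨m, hm⟩
    by_contra! hne
    -- Each round takes at least one step and returns to `[W]`, so a halting time could be decreased
    -- forever.
    have key (m : ℕ) : ∀ t, (step^[m] ([W], T' t)).1 ≠ [] := by
      induction m using Nat.strong_induction_on with
      | _ m ih =>
        intro t h
        obtain ⟨l, hl⟩ := hnext t (hne t)
        by_cases hml : m ≤ l + 1
        · have := habs hml h
          rw [hl] at this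
          simp at this
        · obtain ⟨d, rfl⟩ := Nat.exists_eq_add_of_le' (not_le.1 hml).le
          rw [Function.iterate_add_apply, hl] at h
          exact ih d (by omega) _ h
    have := habs (Nat.le_add_right m m₀) hm
    rw [Function.iterate_add_apply, hm₀] at this
    exact key m 0 this
  · rintro ⟨t, ht⟩
    have key (d s : ℕ) (hs : s + d = t) : ∃ m, (step^[m] ([W], T' s)).1 = [] := by
      induction d generalizing s with
      | zero =>
        obtain rfl : s = t := hs
        exact ⟨1, by rw [Function.iterate_one, step_loop_of_eq _ _ ((hz s).2 ht)]⟩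
      | succ d ih =>
        by_cases h : g (s ::ᵥ v) = 0
        · exact ⟨1, by rw [Function.iterate_one, step_loop_of_eq _ _ ((hz s).2 h)]⟩
        · obtain ⟨l, hl⟩ := hnext s h
          obtain ⟨m, hm⟩ := ih (s + 1) (by omega)
          exact ⟨m + (l + 1), by rw [Function.iterate_add_apply, hl, hm]⟩
    obtain ⟨m, hm⟩ := key t 0 (by omega)
    exact ⟨m + m₀, by rw [Function.iterate_add_apply, hm₀, hm]⟩

end WhileProg

-- Words sorted into blocks

section BlockWord

variable {α : Type*} {n : ℕ}

theorem exists_eq_blockWord_of_mem_letterBlocks (a : Fin n → α) {w : List α}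
    (hw : w ∈ letterBlocks a) : ∃ v, w = blockWord a v := by
  induction n generalizing w with
  | zero =>
    refine ⟨List.Vector.nil, ?_⟩
    simpa [letterBlocks, blockWord] using hw
  | succ n ih =>
    rw [letterBlocks, List.ofFn_succ, List.prod_cons, Language.mem_mul] at hw
    obtain ⟨x, hx, y, hy, rfl⟩ := hw
    obtain ⟨v, rfl⟩ := ih (fun i => a i.succ) hy
    obtain ⟨l, rfl, hl⟩ := Language.mem_kstar.1 hx
    refine ⟨l.length ::ᵥ v, ?_⟩
    have : l = List.replicate l.length [a 0] := List.eq_replicate_iff.2 ⟨rfl, hl⟩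
    rw [this]
    simp [blockWord, List.ofFn_succ]

/-- Every block of a letter equal to `x` is at or before every block of a letter equal to `y`. -/
def BlockLE (a : Fin n → α) (x y : α) : Prop :=
  ∀ i k, a i = x → a k = y → i ≤ k

/-- `w` consists of letters `a i`, in increasing order of `i`. -/
def IsBlockSorted (a : Fin n → α) (w : List α) : Prop :=
  (∀ x ∈ w, x ∈ Set.range a) ∧ w.Pairwise (BlockLE a)

theorem isBlockSorted_blockWord {a : Fin n → α} (ha : Function.Injective a)
    (v : List.Vector ℕ n) : IsBlockSorted a (blockWord a v) := by
  refine ⟨fun x hx => ?_, ?_⟩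
  · simp only [blockWord, List.mem_flatten, List.mem_ofFn] at hx
    obtain ⟨_, ⟨i, rfl⟩, hx⟩ := hx
    exact ⟨i, (List.eq_of_mem_replicate hx).symm⟩
  · rw [blockWord, List.pairwise_flatten]
    constructor
    · intro l hl
      obtain ⟨i, rfl⟩ := List.mem_ofFn.1 hl
      refine List.pairwise_replicate.2 (.inr fun j k hj hk => ?_)
      rw [ha hj, ha hk]
    · rw [List.pairwise_ofFn]
      intro i j hij x hx y hy i' j' hi' hj'
      rw [List.eq_of_mem_replicate hx] at hi'
      rw [List.eq_of_mem_replicate hy] at hj'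
      rw [ha hi', ha hj']
      exact hij.le

theorem count_blockWord [DecidableEq α] {a : Fin n → α} (ha : Function.Injective a)
    (v : List.Vector ℕ n) (i : Fin n) : (blockWord a v).count (a i) = v.get i := by
  simp [blockWord, List.count_flatten, List.map_ofFn, List.sum_ofFn, Function.comp_def,
    List.count_replicate, ha.eq_iff]

/-- Both words are sorted and have the same letter counts, and `BlockLE a` is antisymmetric on the
range of `a`. Outside that range it holds vacuously, so the range condition is needed. -/
theorem IsBlockSorted.eq_blockWord [DecidableEq α] {a : Fin n → α} (ha : Function.Injective a)
    {w : List α} (hw : IsBlockSorted a w) :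
    w = blockWord a (List.Vector.ofFn fun i => w.count (a i)) := by
  have hs := isBlockSorted_blockWord ha (List.Vector.ofFn fun i => w.count (a i))
  refine List.Perm.eq_of_pairwise (le := BlockLE a) ?_ hw.2 hs.2 (List.perm_iff_count.2 fun x => ?_)
  · intro x y hx hy hxy hyx
    obtain ⟨i, rfl⟩ := hw.1 x hx
    obtain ⟨k, rfl⟩ := hs.1 y hy
    rw [le_antisymm (hxy i k rfl rfl) (hyx k i rfl rfl)]
  · by_cases hx : x ∈ Set.range a
    · obtain ⟨i, rfl⟩ := hx
      simp [count_blockWord ha]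
    · rw [List.count_eq_zero_of_not_mem (mt (hw.1 x) hx),
        List.count_eq_zero_of_not_mem (mt (hs.1 x) hx)]

/-- A trailing input letter `y` is one of the `a i`, and all input letters precede it in the
block order. -/
def LastBlockMax {Γ : Type*} (a : Fin n → α) (u : List (α ⊕ Γ)) : Prop :=
  ∀ y, u.getLast? = some (Sum.inl y) → ∀ x, Sum.inl x ∈ u → y ∈ Set.range a ∧ BlockLE a x y

theorem forall_prefix_lastBlockMax_iff {Γ : Type*} {a : Fin n → α} (ha : Function.Injective a)
    (w : List α) :
    (∀ u, u <+: w.map (Sum.inl : α → α ⊕ Γ) → LastBlockMax a u) ↔ IsBlockSorted a w := by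
  have hrefl (y : α) : BlockLE a y y := fun i k hi hk => (ha (hi.trans hk.symm)).le
  induction w using List.reverseRecOn with
  | nil => simp [LastBlockMax, IsBlockSorted]
  | append_singleton w y ih =>
    have hy : LastBlockMax a (w.map (Sum.inl : α → α ⊕ Γ) ++ [Sum.inl y]) ↔
        y ∈ Set.range a ∧ ∀ x ∈ w, BlockLE a x y := by
      simp only [LastBlockMax, List.getLast?_concat, Option.some.injEq, Sum.inl.injEq,
        forall_eq', List.mem_append, List.mem_map, exists_eq_right, List.mem_singleton]
      constructor
      · exact fun h => ⟨(h y (.inr rfl)).1, fun x hx => (h x (.inl hx)).2⟩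
      · rintro ⟨h1, h2⟩ x (hx | rfl)
        exacts [⟨h1, h2 x hx⟩, ⟨h1, hrefl x⟩]
    simp only [List.map_append, List.map_singleton, List.prefix_concat_iff, forall_eq_or_imp, ih]
    rw [hy, IsBlockSorted, IsBlockSorted]
    simp only [List.mem_append, List.mem_singleton, List.pairwise_append, List.pairwise_singleton,
      forall_eq, true_and]
    grind

open Classical in
theorem expressible_lastBlockMax {Γ : Type*} [Finite α] [Finite Γ] (a : Fin n → α) :
    CRASP.Expressible (LastBlockMax (Γ := Γ) a) := by
  have hsum {A : Type _} (c : A → ℤ) (hc : ∀ z, 0 ≤ c z) (w : List A) :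
      (w.map c).sum ≤ 0 ↔ ∀ z ∈ w, c z = 0 := by
    have hpos (w : List A) : 0 ≤ (w.map c).sum := List.sum_nonneg (by simpa using fun z _ => hc z)
    induction w with
    | nil => simp
    | cons z w ih =>
      have := hc z
      have := hpos w
      simp only [List.map_cons, List.sum_cons, List.forall_mem_cons, ← ih]
      omega
  -- Weight 1 marks the letters that must not occur in a word ending in `y`; none occurs iff the
  -- total weight is at most 0.
  let c (y : α) : α ⊕ Γ → ℤ :=
    Sum.elim (fun x => if y ∈ Set.range a ∧ BlockLE a x y then 0 else 1) 0
  have hc (y : α) (z : α ⊕ Γ) : 0 ≤ c y z := by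
    rcases z with x | q
    · simp only [c, Sum.elim_inl]
      split_ifs <;> simp
    · simp [c]
  refine (CRASP.Expressible.forall fun y : α => (CRASP.Expressible.getLast?_eq (Sum.inl y)).not.or
    ((CRASP.ExpressibleTerm.map_sum (c y)).le (CRASP.ExpressibleTerm.const 0))).congr fun w => ?_
  refine forall_congr' fun y => ?_
  rw [hsum _ (hc y), ← imp_iff_not_or]
  refine imp_congr_right fun _ => ?_
  simp [c]

end BlockWord

-- Simulation of while programs by chain of thought

namespace CoTCRASP

open WhileProg

/-- Halting of a while program on the letter counts of a sorted word is recognized by a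
CoT C-RASP, whose tokens are the continuations of the program. -/
theorem exists_language_eq_halting {α : Type*} [Finite α] [DecidableEq α] {n : ℕ} {a : Fin n → α}
    (ha : Function.Injective a) (P : WhileProg) :
    ∃ (Γ : Type) (_ : Finite Γ) (S : CoTCRASP α Γ), S.language = {w | IsBlockSorted a w ∧
      ∃ m, (step^[m] ([P], initial (List.Vector.ofFn fun i => w.count (a i)))).1 = []} := by
  classical
  obtain ⟨Q, hfin, hP, hnil, hyes, hno⟩ := exists_finite_closed P
  have : Finite Q := hfin
  have : Nonempty (α ⊕ Q) := ⟨.inr ⟨_, hP⟩⟩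
  let weight (r : ℕ) : α ⊕ Q → ℤ :=
    Sum.elim (fun x => if ∃ i : Fin n, i.1 = r ∧ a i = x then 1 else 0) fun q => effect q.1 r
  let T (r : ℕ) (w : List (α ⊕ Q)) : ℤ := (w.map (weight r)).sum
  let E (q : Q) (w : List (α ⊕ Q)) : Prop := T (test q.1).1 w = T (test q.1).2 w
  let Sorted (w : List (α ⊕ Q)) : Prop := ∀ u, u <+: w → LastBlockMax a u
  -- The last token already counts towards `T`, so `E` compares registers after its effect, as
  -- `step` does.
  let out (w : List (α ⊕ Q)) : Option (α ⊕ Q) :=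
    match w.getLast? with
    | some (.inr q) =>
      some (.inr (if E q w then ⟨yes q.1, hyes _ q.2⟩ else ⟨no q.1, hno _ q.2⟩))
    | _ => if Sorted w then some (.inr ⟨[P], hP⟩) else none
  have hE (q : Q) : CRASP.Expressible (E q) :=
    (CRASP.ExpressibleTerm.map_sum _).eq (CRASP.ExpressibleTerm.map_sum _)
  have hSorted : CRASP.Expressible Sorted :=
    (expressible_lastBlockMax a).forall_prefix fun y h => by simp at h
  obtain ⟨S, hacc, hS⟩ := exists_output_eq out (fun b => by
    refine ((CRASP.Expressible.exists fun q : Q =>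
      (CRASP.Expressible.getLast?_eq (Sum.inr q)).and
        (((hE q).and (.const (Sum.inr ⟨yes q.1, hyes _ q.2⟩ = b))).or
          ((hE q).not.and (.const (Sum.inr ⟨no q.1, hno _ q.2⟩ = b))))).or
      ((CRASP.Expressible.exists fun q : Q => .getLast?_eq (Sum.inr q)).not.and
        (hSorted.and (.const (Sum.inr ⟨[P], hP⟩ = b))))).congr fun w => ?_
    simp only [out]
    rcases w.getLast? with _ | x | q
    · simp
    · simp
    · by_cases h : E q w <;> simp [h]) {.inr ⟨[], hnil⟩}
  refine ⟨Q, inferInstance, S, ?_⟩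
  ext w
  have hsorted : Sorted (w.map Sum.inl) ↔ IsBlockSorted a w :=
    forall_prefix_lastBlockMax_iff ha w
  have hlast (q : Q) : (w.map (Sum.inl : α → α ⊕ Q)).getLast? ≠ some (.inr q) := by
    intro h
    simpa using List.mem_of_getLast? h
  have hstart : S.output (w.map Sum.inl) =
      if Sorted (w.map Sum.inl) then some (.inr ⟨[P], hP⟩) else none := by
    rw [hS]
    simp only [out]
  by_cases hw : IsBlockSorted a w
  · let c (m : ℕ) := step^[m] ([P], initial (List.Vector.ofFn fun i => w.count (a i)))
    have hsucc (m : ℕ) : c (m + 1) = step (c m) := Function.iterate_succ_apply' _ _ _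
    have hc (m : ℕ) : (c m).1 ∈ Q := by
      induction m with
      | zero => exact hP
      | succ m ih =>
        rw [hsucc, step]
        split_ifs
        exacts [hyes _ ih, hno _ ih]
    let t (m : ℕ) : α ⊕ Q := .inr ⟨(c m).1, hc m⟩
    let W (m : ℕ) : List (α ⊕ Q) := w.map Sum.inl ++ (List.range m).map t
    have hW (m : ℕ) : W (m + 1) = W m ++ [t m] := by simp [W, List.range_succ]
    -- Invariant of the simulation: `W m` carries the tokens of the first `m` steps, so its weighted
    -- counts are the registers after `m` steps.
    have hT (m r : ℕ) : T r (W m) = (c m).2 r := by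
      induction m with
      | zero =>
        simp only [W, T, c, List.range_zero, List.map_nil, List.append_nil, Function.iterate_zero,
          id_eq, initial, List.map_map]
        split_ifs with hr
        · have h (x : α) : (weight r ∘ Sum.inl) x = if x = a ⟨r, hr⟩ then 1 else 0 := by
            simp only [weight, Function.comp_apply, Sum.elim_inl]
            refine if_congr ⟨?_, ?_⟩ rfl rfl
            · rintro ⟨i, rfl, rfl⟩
              rfl
            · rintro rfl
              exact ⟨_, rfl, rfl⟩
          rw [List.map_congr_left fun x _ => h x, List.Vector.get_ofFn]
          clear hsorted hlast hstart hw c hsucc hc t W hW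
          induction w with
          | nil => simp
          | cons x w ih => simp [ih, List.count_cons, add_comm]
        · refine List.sum_eq_zero fun y hy => ?_
          obtain ⟨x, -, rfl⟩ := List.mem_map.1 hy
          simp only [weight, Function.comp_apply, Sum.elim_inl]
          exact if_neg fun ⟨i, hi, _⟩ => hr (hi ▸ i.2)
      | succ m ih =>
        rw [hW, hsucc]
        simp only [T] at ih ⊢
        rw [List.map_append, List.sum_append, ih]
        simp [t, weight, step]
    have ht (m : ℕ) : S.output (W m) = some (t m) := by
      cases m with
      | zero =>
        rw [if_pos (hsorted.2 hw)] at hstart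
        exact hstart ▸ congrArg S.output (List.append_nil _)
      | succ m =>
        rw [hS]
        have : (W (m + 1)).getLast? = some (.inr ⟨(c m).1, hc m⟩) := by simp [hW, t]
        simp only [out, this, E, hT, t, hsucc, step]
        congr 2
        split_ifs <;> rfl
    have h0 : W 0 = w.map Sum.inl := by simp [W]
    have := exists_generates_iff hW ht
    rw [h0] at this
    refine (this.trans ?_).trans (and_iff_right hw).symm
    simp [hacc, t, c]
  -- An unsorted input gets no first token, so nothing is ever generated.
  · have hnone : S.output (w.map Sum.inl) = none := by rw [hstart, if_neg (hsorted.not.2 hw)]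
    refine iff_of_false ?_ fun h => hw h.1
    rintro ⟨u, b, h, -⟩
    cases u <;> simp [Generates, hnone] at h

end CoTCRASP

theorem mainTheorem2 {α : Type*} [Finite α] [Primcodable α]
    (n : ℕ) (a : Fin n → α) (ha : Function.Injective a)
    (L : Language α) (hL : L ≤ letterBlocks a)
    (hre : REPred (fun w : List α => w ∈ L)) :
    ∃ (Γ : Type) (_ : Finite Γ) (S : CoTCRASP α Γ), S.language = L := by
  classical
  obtain ⟨g, hg, hgL⟩ := exists_primrec_blockWord a hre
  obtain ⟨P, hP⟩ := WhileProg.exists_search hg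
  obtain ⟨Γ, hΓ, S, hS⟩ := CoTCRASP.exists_language_eq_halting ha P
  refine ⟨Γ, hΓ, S, hS.trans ?_⟩
  ext w
  refine (and_congr_right' (hP _)).trans ?_
  rw [← hgL]
  constructor
  · rintro ⟨hw, h⟩
    rwa [← hw.eq_blockWord ha] at h
  · intro h
    obtain ⟨v, rfl⟩ := exists_eq_blockWord_of_mem_letterBlocks a (hL h)
    have hw := isBlockSorted_blockWord ha v
    exact ⟨hw, by rwa [← hw.eq_blockWord ha]⟩
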